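/- For two integrable real random variables let $d_W(X,Y)=\inf_\pi\int|x-y|\,\pi(dx,dy)$ be the Wasserstein distance, the infimum being over all couplings $\pi$ of the laws of $X$ and $Y$. For $\alpha,\beta>0$ let $B(\alpha,\beta)=\int_0^1t^{\alpha-1}(1-t)^{\beta-1}dt$ and $B_i(x,\alpha,\beta)=\int_0^xt^{\alpha-1}(1-t)^{\beta-1}dt$ ($0\le x\le1$) be the Beta and incomplete Beta functions. For $a>0$ and $b\in\mathbb R$ put $$F(\alpha,\beta,a,b)=\frac1{B(\alpha,\beta)}\begin{cases}-2aB_i(-\tfrac ba,\alpha+1,\beta)-2bB_i(-\tfrac ba,\alpha,\beta)+aB(\alpha+1,\beta)+bB(\alpha,\beta)&\text{if }-a<b\le0,\\ aB(\alpha+1,\beta)+bB(\alpha,\beta)&\text{if }b>0,\\ -\bigl(aB(\alpha+1,\beta)+bB(\alpha,\beta)\bigr)&\text{if }b\le-a,\end{cases}$$ and $F(\alpha,\beta,0,b)=|b|$, $F(\alpha,\beta,a,b)=F(\alpha,\beta,-a,-b)$ for $a<0$. Let $$C_{\alpha,\beta}=\frac{B(\alpha+2,\beta)+B(\alpha,\beta+2)}{B(\alpha,\beta)}+F(\alpha,\beta,2,-1)+F(\alpha,\beta,\alpha+\beta-2,1-\alpha)+\frac3{\sqrt{2\pi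 e}}.$$ (1) Let $\alpha,\beta>0$ and let $\theta\sim\mathrm{Beta}(\alpha,\beta)$. Then $\mathbb E|a\theta+b|=F(\alpha,\beta,a,b)$ for all $a,b\in\mathbb R$. Moreover, let $(X_k)_{k\ge1}$ be a sequence of $0$-$1$ random variables with de Finetti mixing measure $\mathrm{Beta}(\alpha,\beta)$, that is, for all $n\ge1$, $(e_1,\dots,e_n)\in\{0,1\}^n$ and $k=\sum_i e_i$, $$\mathbb P[X_1=e_1,\dots,X_n=e_n]=\mathbb E[\theta^k(1-\theta)^{n-k}]$$ (the law of a sequence that is, conditionally on $\theta$, i.i.d. Bernoulli with parameter $\theta$). Then, with $\bar X_n=n^{-1}\sum_{i=1}^nX_i$, for every $n\ge1$, $$d_W(\bar X_n,\theta)\le\frac{C_{\alpha,\beta}}n.$$ (2) Let $A,B,m\ge1$ be integers. Consider a Pólya–Eggenberger urn containing initially $A$ white balls and $B$ black balls, where at each draw a ball is drawn uniformly at random and replaced along with $m$ additional balls of the same color. Let $\bar X_n$ be the number of white balls drawn in the first $n$ draws, divided by $n$, and let $\theta\sim\mathrm{Beta}(A/m,B/m)$. Then, for every $n\ge1$, $$d_W(\bar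 X_n,\theta)\le\frac{C_{A/m,B/m}}n.$$ -/

import Mathlib

open MeasureTheory ProbabilityTheory

noncomputable section

/-- The Wasserstein (Kantorovich) distance between two measures on the real line:
the infimum of `∫ |x - y| dπ(x, y)` over all couplings `π`, i.e. all measures on `ℝ × ℝ` with first
marginal `μ` and second marginal `ν`. It takes values in `[0, ∞]`. -/
def wassersteinDist (μ ν : Measure ℝ) : ENNReal :=
  ⨅ (π : Measure (ℝ × ℝ)) (_ : π.map Prod.fst = μ ∧ π.map Prod.snd = ν),
    ∫⁻ z, ENNReal.ofReal |z.1 - z.2| ∂π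

/-- The empirical mean `n⁻¹ ∑ X_i` of the first `n` terms (indexed from `0`) of a sequence. -/
def empiricalMean {Ω : Type*} (X : ℕ → Ω → ℕ) (n : ℕ) (ω : Ω) : ℝ :=
  (∑ i ∈ Finset.range n, (X i ω : ℝ)) / n

/-- The event that the first `n` terms of the sequence are `e 0, …, e (n - 1)`. -/
def historyEvent {Ω : Type*} (X : ℕ → Ω → ℕ) {n : ℕ} (e : Fin n → ℕ) : Set Ω :=
  {ω | ∀ i : Fin n, X i ω = e i}

/-- `X` is a sequence of `0`-`1` random variables. -/
structure IsZeroOneSequence {Ω : Type*} [MeasurableSpace Ω] (X : ℕ → Ω → ℕ) : Prop where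
  measurable : ∀ i, Measurable (X i)
  zero_or_one : ∀ i ω, X i ω = 0 ∨ X i ω = 1

/-- `X` is a sequence of `0`-`1` random variables with mixing (de Finetti) measure `μ` on `[0, 1]`:
`P[X_1 = e_1, …, X_n = e_n] = ∫ t ^ k * (1 - t) ^ (n - k) μ(dt)` with `k = ∑ e_i`. This is the law of
a sequence that, conditionally on a random variable `θ` with law `μ`, is i.i.d. Bernoulli with
parameter `θ`. -/
structure HasMixingMeasure {Ω : Type*} [MeasurableSpace Ω] (P : Measure Ω) (X : ℕ → Ω → ℕ)
    (μ : Measure ℝ) : Prop extends IsZeroOneSequence X where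
  prob_history : ∀ (n : ℕ) (e : Fin n → ℕ), (∀ i, e i = 0 ∨ e i = 1) →
    P.real (historyEvent X e) = ∫ t in Set.Icc (0 : ℝ) 1, t ^ (∑ i, e i) * (1 - t) ^ (n - ∑ i, e i) ∂μ

/-- The number of white balls in the urn after the draws `e 0, …, e (n - 1)` (`1` means white),
when the urn starts with `A` white balls and each drawn ball is replaced along with `m` additional
balls of the same color. -/
def urnWhite (A m : ℕ) {n : ℕ} (e : Fin n → ℕ) : ℕ := A + ∑ i, if e i = 1 then m else 0

/-- The number of black balls in the urn after the draws `e 0, …, e (n - 1)` (`0` means black),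
when the urn starts with `B` black balls. -/
def urnBlack (B m : ℕ) {n : ℕ} (e : Fin n → ℕ) : ℕ := B + ∑ i, if e i = 0 then m else 0

/-- `X` records the successive draws (`1` for white, `0` for black) from a Pólya–Eggenberger urn
starting with `A` white and `B` black balls, each drawn ball being replaced along with `m` additional
balls of the same color: given the past draws, the next ball is uniform among the balls
in the urn. -/
structure IsPolyaUrn {Ω : Type*} [MeasurableSpace Ω] (P : Measure Ω) (A B m : ℕ)
    (X : ℕ → Ω → ℕ) : Prop extends IsZeroOneSequence X where
  prob_white : ∀ (n : ℕ) (e : Fin n → ℕ), (∀ i, e i = 0 ∨ e i = 1) →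
    P.real (historyEvent X e ∩ {ω | X n ω = 1}) =
      P.real (historyEvent X e) * ((urnWhite A m e : ℝ) / (urnWhite A m e + urnBlack B m e))

/-- The incomplete Beta function `∫_0^x t ^ (α - 1) * (1 - t) ^ (β - 1) dt`. -/
def incompleteBeta (x α β : ℝ) : ℝ := ∫ t in (0 : ℝ)..x, t ^ (α - 1) * (1 - t) ^ (β - 1)

/-- Mathlib's Beta function (a quotient of Gamma values) is Euler's integral. -/
theorem beta_eq_incompleteBeta_one {α β : ℝ} (hα : 0 < α) (hβ : 0 < β) :
    beta α β = incompleteBeta 1 α β := by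
  have h : Complex.betaIntegral α β = ((incompleteBeta 1 α β : ℝ) : ℂ) := by
    unfold Complex.betaIntegral incompleteBeta
    rw [← intervalIntegral.integral_ofReal]
    refine intervalIntegral.integral_congr fun t ht => ?_
    rw [Set.uIcc_of_le zero_le_one] at ht
    have h1 : (0 : ℝ) ≤ 1 - t := by linarith [ht.2]
    push_cast [Complex.ofReal_cpow ht.1, Complex.ofReal_cpow h1]
    rfl
  rw [beta_eq_betaIntegralReal α β hα hβ, h, Complex.ofReal_re]

/-- The value of `E|a θ + b|`, `θ ∼ Beta(α, β)`, written through the Beta and incomplete Beta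
functions, for `a > 0`. -/
def betaAbsMomentPos (α β a b : ℝ) : ℝ :=
  if 0 < b then (a * beta (α + 1) β + b * beta α β) / beta α β
  else if b ≤ -a then -((a * beta (α + 1) β + b * beta α β) / beta α β)
  else (-2 * a * incompleteBeta (-b / a) (α + 1) β - 2 * b * incompleteBeta (-b / a) α β
    + a * beta (α + 1) β + b * beta α β) / beta α β

/-- The function `F(α, β, a, b)`, for all real `a` and `b`. -/
def betaAbsMoment (α β a b : ℝ) : ℝ :=
  if 0 < a then betaAbsMomentPos α β a b
  else if a = 0 then |b|
  else betaAbsMomentPos α β (-a) (-b)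

/-- The constant `C_{α,β}`. -/
def betaConst (α β : ℝ) : ℝ :=
  (beta (α + 2) β + beta α (β + 2)) / beta α β + betaAbsMoment α β 2 (-1)
    + betaAbsMoment α β (α + β - 2) (1 - α) + 3 / Real.sqrt (2 * Real.pi * Real.exp 1)

end

/-! On the line, coupling by quantiles bounds the Wasserstein distance by the `L¹` distance of the
distribution functions (`wassersteinDist_le_lintegral_cdf`). Let `F` be the distribution function of
`θ` and `p` its density. The distribution function of the empirical mean is constant on each cell
`[k/n, (k+1)/n)`, where it equals the integral of `binomialCdf n k` against the mixing law.

By the duality between binomial and Beta laws, that integral is `E[F(V_k)]`, where `V_k` is the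
`k`-th (from 0) order statistic of `n` uniform points, with mean `m_k = (k+1)/(n+1)`. Expanding `F`
at `m_k`, the linear term has mean zero, and the remainder is at most the integral of `|p'(t)|`
against `E[(t - V_k)⁺] - (t - m_k)⁺`, a Jensen gap. The order statistics together are `n` uniform
points, so these gaps can be summed over `k` explicitly: the total is at most `t(1-t)/2`
(`sum_integral_taylorKernel_le`). This weight cancels the poles of `p'/p` at 0 and 1, and leaves
`E|(α+β-2)θ + 1-α| / 2`.

Replacing `F(x)` by `F(m_k)` within a cell costs the increment of `F` there, in total at most 1.
Every cell has length `1/n`, so the distance is at most `(1 + F(α,β,α+β-2,1-α)/2)/n`, and the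
constant is below `C_{α,β}`. The urn reduces to this case, because its draws have mixing law
`Beta(A/m, B/m)`. -/

/-! ### Quantile coupling on the real line -/

/-- The quantile function (generalized inverse of the cdf) of a measure on the real line. -/
noncomputable def quantileFun (μ : Measure ℝ) (u : ℝ) : ℝ := sInf {x | u ≤ cdf μ x}

/-- Right continuity makes the infimum attained. The level must lie in `(0, 1)` so that the limits
of the cdf at `±∞` make the set bounded below and nonempty. -/
theorem quantileFun_le_iff (μ : Measure ℝ) {u : ℝ} (hu : u ∈ Set.Ioo (0 : ℝ) 1) (x : ℝ) :
    quantileFun μ u ≤ x ↔ u ≤ cdf μ x := by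
  have hbdd : BddBelow {x | u ≤ cdf μ x} := by
    obtain ⟨y, hy⟩ := ((tendsto_cdf_atBot μ).eventually (gt_mem_nhds hu.1)).exists
    refine ⟨y, fun z hz => ?_⟩
    by_contra! h
    exact absurd (hz.trans (monotone_cdf μ h.le)) (not_le.2 hy)
  have hne : {x | u ≤ cdf μ x}.Nonempty := by
    obtain ⟨y, hy⟩ := ((tendsto_cdf_atTop μ).eventually (lt_mem_nhds hu.2)).exists
    exact ⟨y, hy.le⟩
  refine ⟨fun h => ?_, fun h => csInf_le hbdd h⟩
  have hright : Filter.Tendsto (cdf μ) (nhdsWithin x (Set.Ioi x)) (nhds (cdf μ x)) :=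
    ((cdf μ).right_continuous x).mono_left (nhdsWithin_mono _ Set.Ioi_subset_Ici_self)
  refine ge_of_tendsto hright ?_
  filter_upwards [self_mem_nhdsWithin] with y hy
  obtain ⟨z, hz, hzy⟩ := exists_lt_of_csInf_lt hne (lt_of_le_of_lt h hy)
  exact le_trans hz (monotone_cdf μ hzy.le)

theorem monotoneOn_quantileFun (μ : Measure ℝ) :
    MonotoneOn (quantileFun μ) (Set.Ioo (0 : ℝ) 1) := fun _ hu _ hv huv =>
  (quantileFun_le_iff μ hu _).2 (huv.trans ((quantileFun_le_iff μ hv _).1 le_rfl))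

theorem aemeasurable_quantileFun (μ : Measure ℝ) :
    AEMeasurable (quantileFun μ) (volume.restrict (Set.Ioo (0 : ℝ) 1)) :=
  aemeasurable_restrict_of_monotoneOn measurableSet_Ioo (monotoneOn_quantileFun μ)

theorem map_quantileFun (μ : Measure ℝ) [IsProbabilityMeasure μ] :
    (volume.restrict (Set.Ioo (0 : ℝ) 1)).map (quantileFun μ) = μ := by
  have : IsFiniteMeasure ((volume.restrict (Set.Ioo (0 : ℝ) 1)).map (quantileFun μ)) := by
    infer_instance
  refine Measure.ext_of_Iic _ _ fun x => ?_
  rw [Measure.map_apply_of_aemeasurable (aemeasurable_quantileFun μ) measurableSet_Iic,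
    Measure.restrict_apply' measurableSet_Ioo, ← ofReal_cdf]
  have h : quantileFun μ ⁻¹' Set.Iic x ∩ Set.Ioo 0 1 = Set.Iic (cdf μ x) ∩ Set.Ioo 0 1 := by
    ext u
    simp only [Set.mem_inter_iff, Set.mem_preimage, Set.mem_Iic, and_congr_left_iff]
    exact fun hu => quantileFun_le_iff μ hu x
  rw [h]
  apply le_antisymm
  · calc volume (Set.Iic (cdf μ x) ∩ Set.Ioo 0 1) ≤ volume (Set.Ioc 0 (cdf μ x)) :=
          measure_mono fun u hu => ⟨hu.2.1, hu.1⟩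
      _ = _ := by rw [Real.volume_Ioc, sub_zero]
  · calc ENNReal.ofReal (cdf μ x) = volume (Set.Ioo 0 (cdf μ x)) := by
          rw [Real.volume_Ioo, sub_zero]
      _ ≤ volume (Set.Iic (cdf μ x) ∩ Set.Ioo 0 1) := measure_mono fun u hu =>
          ⟨hu.2.le, hu.1, hu.2.trans_le (cdf_le_one μ x)⟩

/-- On the real line the Wasserstein distance is at most the `L¹` distance of the distribution
functions. -/
theorem wassersteinDist_le_lintegral_cdf (μ ν : Measure ℝ) [IsProbabilityMeasure μ]
    [IsProbabilityMeasure ν] :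
    wassersteinDist μ ν ≤ ∫⁻ x, ENNReal.ofReal |cdf μ x - cdf ν x| := by
  set lam : Measure ℝ := volume.restrict (Set.Ioo (0 : ℝ) 1) with hlam
  have hpair : AEMeasurable (fun u => (quantileFun μ u, quantileFun ν u)) lam :=
    (aemeasurable_quantileFun μ).prodMk (aemeasurable_quantileFun ν)
  have hπ : (lam.map fun u => (quantileFun μ u, quantileFun ν u)).map Prod.fst = μ ∧
      (lam.map fun u => (quantileFun μ u, quantileFun ν u)).map Prod.snd = ν := by
    rw [AEMeasurable.map_map_of_aemeasurable measurable_fst.aemeasurable hpair,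
      AEMeasurable.map_map_of_aemeasurable measurable_snd.aemeasurable hpair]
    exact ⟨map_quantileFun μ, map_quantileFun ν⟩
  unfold wassersteinDist
  refine (iInf₂_le (f := fun (π : Measure (ℝ × ℝ)) (_ : π.map Prod.fst = μ ∧ π.map Prod.snd = ν) =>
    ∫⁻ z, ENNReal.ofReal |z.1 - z.2| ∂π) _ hπ).trans ?_
  rw [lintegral_map' (by fun_prop) hpair]
  have hF : ∀ ρ : Measure ℝ, MeasurableSet {q : ℝ × ℝ | q.1 ≤ cdf ρ q.2} := fun ρ =>
    measurableSet_le measurable_fst ((monotone_cdf ρ).measurable.comp measurable_snd)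
  have hD : MeasurableSet {q : ℝ × ℝ | ¬ (q.1 ≤ cdf μ q.2 ↔ q.1 ≤ cdf ν q.2)} := by
    have : {q : ℝ × ℝ | ¬ (q.1 ≤ cdf μ q.2 ↔ q.1 ≤ cdf ν q.2)} =
        ({q : ℝ × ℝ | q.1 ≤ cdf μ q.2} \ {q | q.1 ≤ cdf ν q.2}) ∪
        ({q : ℝ × ℝ | q.1 ≤ cdf ν q.2} \ {q | q.1 ≤ cdf μ q.2}) := by
      ext q
      simp only [Set.mem_ofPred_eq, Set.mem_union, Set.mem_sdiff]
      tauto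
    rw [this]
    exact ((hF μ).diff (hF ν)).union ((hF ν).diff (hF μ))
  -- Both sides measure the region between the two graphs. At height `u` its slice is the interval
  -- between the two quantiles; above `x` its slice lies in the interval between the two cdf values.
  -- Tonelli exchanges the slicings.
  calc ∫⁻ u in Set.Ioo (0 : ℝ) 1, ENNReal.ofReal |quantileFun μ u - quantileFun ν u|
      = ∫⁻ u in Set.Ioo (0 : ℝ) 1, ∫⁻ x,
          {q : ℝ × ℝ | ¬ (q.1 ≤ cdf μ q.2 ↔ q.1 ≤ cdf ν q.2)}.indicator 1 (u, x) := by
        refine setLIntegral_congr_fun measurableSet_Ioo fun u hu => ?_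
        have h1 : ∀ x, {q : ℝ × ℝ | ¬ (q.1 ≤ cdf μ q.2 ↔ q.1 ≤ cdf ν q.2)}.indicator
            (1 : ℝ × ℝ → ENNReal) (u, x) =
            (Set.Ico (min (quantileFun μ u) (quantileFun ν u))
              (max (quantileFun μ u) (quantileFun ν u))).indicator 1 x := by
          intro x
          simp only [Set.indicator, Set.mem_ofPred_eq, ← quantileFun_le_iff μ hu,
            ← quantileFun_le_iff ν hu, Set.mem_Ico, min_le_iff, lt_max_iff, Pi.one_apply]
          congr 1
          simp only [eq_iff_iff, ← not_le]
          tauto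
        simp only [h1]
        rw [lintegral_indicator_one measurableSet_Ico, Real.volume_Ico, max_sub_min_eq_abs']
    _ = ∫⁻ x, ∫⁻ u in Set.Ioo (0 : ℝ) 1,
          {q : ℝ × ℝ | ¬ (q.1 ≤ cdf μ q.2 ↔ q.1 ≤ cdf ν q.2)}.indicator 1 (u, x) :=
        lintegral_lintegral_swap ((measurable_one.indicator hD).aemeasurable)
    _ ≤ ∫⁻ x, ENNReal.ofReal |cdf μ x - cdf ν x| := by
        refine lintegral_mono fun x => ?_
        calc _ ≤ ∫⁻ u, {q : ℝ × ℝ | ¬ (q.1 ≤ cdf μ q.2 ↔ q.1 ≤ cdf ν q.2)}.indicator 1 (u, x) :=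
              setLIntegral_le_lintegral _ _
          _ = ∫⁻ u, (Set.Ioc (min (cdf μ x) (cdf ν x)) (max (cdf μ x) (cdf ν x))).indicator 1 u := by
              refine lintegral_congr fun u => ?_
              simp only [Set.indicator, Set.mem_ofPred_eq, Set.mem_Ioc, min_lt_iff, le_max_iff,
                Pi.one_apply]
              congr 1
              simp only [eq_iff_iff, ← not_le]
              tauto
          _ = _ := by
              rw [lintegral_indicator_one measurableSet_Ioc, Real.volume_Ioc, max_sub_min_eq_abs']

/-! ### Binomial laws and uniform order statistics -/

/-- The distribution function at `k` of the binomial law with parameters `n` and `t`. -/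
noncomputable def binomialCdf (n k : ℕ) (t : ℝ) : ℝ :=
  ∑ j ∈ Finset.range (k + 1), (bernsteinPolynomial ℝ n j).eval t

/-- The density of the Beta law with integer parameters `k + 1` and `n - k`, i.e. of the
`k`-th (from `0`) order statistic of `n` uniform variables. -/
noncomputable def orderDensity (n k : ℕ) (t : ℝ) : ℝ :=
  n * (bernsteinPolynomial ℝ (n - 1) k).eval t

theorem bernsteinPolynomial_eval (n k : ℕ) (t : ℝ) :
    (bernsteinPolynomial ℝ n k).eval t = n.choose k * t ^ k * (1 - t) ^ (n - k) := by
  simp [bernsteinPolynomial]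

theorem orderDensity_nonneg (n k : ℕ) {t : ℝ} (ht : t ∈ Set.Icc (0 : ℝ) 1) :
    0 ≤ orderDensity n k t := by
  have h0 := ht.1
  have h1 : 0 ≤ 1 - t := by linarith [ht.2]
  rw [orderDensity, bernsteinPolynomial_eval]
  positivity

@[fun_prop]
theorem continuous_orderDensity (n k : ℕ) : Continuous (orderDensity n k) := by
  unfold orderDensity
  fun_prop

/-- The derivative of each Bernstein polynomial is a difference of two of degree `n - 1`, so the sum
telescopes. -/
theorem hasDerivAt_binomialCdf (n k : ℕ) (t : ℝ) :
    HasDerivAt (binomialCdf n k) (-orderDensity n k t) t := by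
  induction k with
  | zero =>
    have h := (bernsteinPolynomial ℝ n 0).hasDerivAt t
    rw [bernsteinPolynomial.derivative_zero] at h
    have h2 : binomialCdf n 0 = fun t => (bernsteinPolynomial ℝ n 0).eval t := by
      ext s
      simp [binomialCdf]
    rw [h2]
    simpa [orderDensity] using h
  | succ k ih =>
    have h := ih.add ((bernsteinPolynomial ℝ n (k + 1)).hasDerivAt t)
    rw [bernsteinPolynomial.derivative_succ] at h
    have h2 : binomialCdf n (k + 1) =
        binomialCdf n k + fun t => (bernsteinPolynomial ℝ n (k + 1)).eval t := by
      ext s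
      simp [binomialCdf, Finset.sum_range_succ _ (k + 1)]
    rw [h2]
    refine h.congr_deriv ?_
    simp only [orderDensity, Polynomial.eval_mul, Polynomial.eval_natCast, Polynomial.eval_sub]
    ring

theorem binomialCdf_zero (n k : ℕ) : binomialCdf n k 0 = 1 := by
  simp [binomialCdf, bernsteinPolynomial.eval_at_0]

theorem binomialCdf_one {n k : ℕ} (hk : k < n) : binomialCdf n k 1 = 0 := by
  refine Finset.sum_eq_zero fun j hj => ?_
  rw [bernsteinPolynomial.eval_at_1, if_neg]
  have := Finset.mem_range.1 hj
  omega

/-- At most `k` of `n` uniform points fall below `t` exactly when the order statistic number `k`,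
counted from 0, exceeds `t`. For `k = n` the boundary value at 1 would not vanish. -/
theorem integral_orderDensity_Icc {n k : ℕ} (hk : k < n) (t : ℝ) :
    ∫ v in t..1, orderDensity n k v = binomialCdf n k t := by
  have h := intervalIntegral.integral_eq_sub_of_hasDerivAt (a := t) (b := 1)
    (f := fun s => -binomialCdf n k s) (f' := orderDensity n k)
    (fun s _ => (hasDerivAt_binomialCdf n k s).fun_neg.congr_deriv (neg_neg _))
    ((continuous_orderDensity n k).intervalIntegrable _ _)
  rw [h, binomialCdf_one hk]
  ring

theorem integral_orderDensity {n k : ℕ} (hk : k < n) :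
    ∫ v in (0 : ℝ)..1, orderDensity n k v = 1 := by
  rw [integral_orderDensity_Icc hk, binomialCdf_zero]

/-- A factor `v` turns the density, up to the constant sought, into that with `n` and `k` both
raised by one, which has mass 1. -/
theorem integral_orderDensity_mul_id {n k : ℕ} (hk : k < n) :
    ∫ v in (0 : ℝ)..1, orderDensity n k v * v = (k + 1) / (n + 1) := by
  have h := integral_orderDensity (n := n + 1) (k := k + 1) (by omega)
  have h2 : ∀ v : ℝ, orderDensity n k v * v =
      (k + 1) / (n + 1) * orderDensity (n + 1) (k + 1) v := by
    intro v
    obtain ⟨n, rfl⟩ : ∃ m, n = m + 1 := ⟨n - 1, by omega⟩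
    have hc : ((n + 1 : ℕ) : ℝ) * n.choose k = (n + 1).choose (k + 1) * (k + 1 : ℕ) :=
      mod_cast Nat.add_one_mul_choose_eq n k
    have hn : ((n + 1 : ℕ) : ℝ) + 1 ≠ 0 := by positivity
    simp only [orderDensity, bernsteinPolynomial_eval, Nat.add_sub_cancel, Nat.add_sub_add_right]
    push_cast at hc hn ⊢
    field_simp
    linear_combination v * v ^ k * (1 - v) ^ (n - k) * hc
  simp only [h2]
  rw [intervalIntegral.integral_const_mul, h, mul_one]

/-- Forgetting the order, the order statistics are just `n` uniform points. -/
theorem sum_orderDensity {n : ℕ} (hn : 1 ≤ n) (v : ℝ) :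
    ∑ k ∈ Finset.range n, orderDensity n k v = n := by
  have h := congrArg (Polynomial.eval v) (bernsteinPolynomial.sum ℝ (n - 1))
  rw [Polynomial.eval_finsetSum, Polynomial.eval_one, Nat.sub_add_cancel hn] at h
  simp only [orderDensity]
  rw [← Finset.mul_sum, h, mul_one]

/-! ### Peano kernels and their sum over order statistics -/

/-- The Peano kernel at `t` of the first order Taylor expansion at `m`, evaluated at `v`. -/
noncomputable def taylorKernel (v m t : ℝ) : ℝ :=
  max (t - v) 0 + if m < t then v - t else 0

theorem taylorKernel_nonneg (v m t : ℝ) : 0 ≤ taylorKernel v m t := by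
  unfold taylorKernel
  split_ifs
  · linarith [le_max_left (t - v) 0]
  · linarith [le_max_right (t - v) 0]

theorem measurable_taylorKernel (m : ℝ) :
    Measurable fun q : ℝ × ℝ => taylorKernel q.1 m q.2 := by
  unfold taylorKernel
  refine Measurable.add (by fun_prop) (Measurable.ite ?_ (by fun_prop) (by fun_prop))
  exact measurableSet_lt measurable_const measurable_snd

/-- The kernel is in fact `|t - v|` for `t` between `m` and `v`, and zero elsewhere. Its definition
as a positive part plus a term affine in `v` makes averaging over `v` immediate. -/
theorem abs_sub_le_taylorKernel {v m t : ℝ} (ht : t ∈ Set.uIoc m v) :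
    |t - v| ≤ taylorKernel v m t := by
  unfold taylorKernel
  rcases Set.mem_uIoc.1 ht with h | h
  · rw [if_pos h.1, abs_of_nonpos (by linarith)]
    linarith [le_max_right (t - v) 0]
  · rw [if_neg (by linarith), abs_of_nonneg (by linarith)]
    linarith [le_max_left (t - v) 0]

/-- Keeping the terms with `k < r = ⌊(n+1)t⌋` gives an arithmetic sum. With `x = (n+1)t - r` in `[0,
1)`, it exceeds the claimed bound by `x(1-x)/(2(n+1))`. -/
theorem sum_max_sub_ge {n : ℕ} {t : ℝ} (ht : t ∈ Set.Ioo (0 : ℝ) 1) :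
    n * t ^ 2 / 2 - t * (1 - t) / 2 ≤
      ∑ k ∈ Finset.range n, max (t - ((k : ℝ) + 1) / (n + 1)) 0 := by
  have hn : (0 : ℝ) < n + 1 := by positivity
  obtain ⟨r, hr⟩ : ∃ r : ℕ, r = ⌊((n : ℝ) + 1) * t⌋₊ := ⟨_, rfl⟩
  have h0 : 0 ≤ ((n : ℝ) + 1) * t := mul_nonneg hn.le ht.1.le
  have h1 : (r : ℝ) ≤ (n + 1) * t := hr ▸ Nat.floor_le h0
  have h2 : (n + 1) * t < r + 1 := hr ▸ Nat.lt_floor_add_one _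
  have hrn : r ≤ n := by
    have : (r : ℝ) < n + 1 := by nlinarith [ht.2]
    exact Nat.lt_succ_iff.1 (by exact_mod_cast this)
  have hs : ∀ r : ℕ, ∑ k ∈ Finset.range r, (t - ((k : ℝ) + 1) / (n + 1)) =
      r * t - r * (r + 1) / (2 * (n + 1)) := by
    intro r
    induction r with
    | zero => simp
    | succ r ih =>
      rw [Finset.sum_range_succ, ih]
      push_cast
      field_simp
      ring
  calc n * t ^ 2 / 2 - t * (1 - t) / 2 ≤ r * t - r * (r + 1) / (2 * (n + 1)) := by
        have : r * t - r * (r + 1) / (2 * (n + 1)) - (n * t ^ 2 / 2 - t * (1 - t) / 2) =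
            ((n + 1) * t - r) * (1 - ((n + 1) * t - r)) / (2 * (n + 1)) := by
          field_simp
          ring
        have h3 : 0 ≤ ((n + 1) * t - r) * (1 - ((n + 1) * t - r)) / (2 * ((n : ℝ) + 1)) :=
          div_nonneg (mul_nonneg (by linarith) (by linarith)) (by positivity)
        linarith
    _ = ∑ k ∈ Finset.range r, (t - ((k : ℝ) + 1) / (n + 1)) := (hs r).symm
    _ ≤ ∑ k ∈ Finset.range r, max (t - ((k : ℝ) + 1) / (n + 1)) 0 :=
        Finset.sum_le_sum fun k _ => le_max_left _ _
    _ ≤ _ := Finset.sum_le_sum_of_subset_of_nonneg (Finset.range_mono hrn)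
        fun _ _ _ => le_max_right _ _

theorem integral_max_sub {t : ℝ} (ht : t ∈ Set.Ioo (0 : ℝ) 1) :
    ∫ v in (0 : ℝ)..1, max (t - v) 0 = t ^ 2 / 2 := by
  have hi : ∀ a b : ℝ, IntervalIntegrable (fun v => max (t - v) 0) volume a b := fun a b =>
    (by fun_prop : Continuous fun v => max (t - v) 0).intervalIntegrable a b
  rw [← intervalIntegral.integral_add_adjacent_intervals (hi 0 t) (hi t 1)]
  have h1 : ∫ v in (0 : ℝ)..t, max (t - v) 0 = ∫ v in (0 : ℝ)..t, (t - v) := by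
    refine intervalIntegral.integral_congr fun v hv => ?_
    rw [Set.uIcc_of_le ht.1.le] at hv
    exact max_eq_left (by linarith [hv.2])
  have h2 : ∫ v in t..1, max (t - v) 0 = ∫ v in t..1, (0 : ℝ) := by
    refine intervalIntegral.integral_congr fun v hv => ?_
    rw [Set.uIcc_of_le ht.2.le] at hv
    exact max_eq_right (by linarith [hv.1])
  rw [h1, h2, intervalIntegral.integral_sub (by simp) (by simp)]
  simp
  ring

/-- The affine part of the kernel only sees the mean of the order statistic, so the average is the
Jensen gap of the convex function `v ↦ (t - v)⁺`. -/
theorem integral_orderDensity_mul_taylorKernel {n k : ℕ} (hk : k < n) (t : ℝ) :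
    ∫ v in (0 : ℝ)..1, orderDensity n k v * taylorKernel v ((k + 1) / (n + 1)) t =
      (∫ v in (0 : ℝ)..1, orderDensity n k v * max (t - v) 0) -
        max (t - ((k : ℝ) + 1) / (n + 1)) 0 := by
  have hc : ∀ f : ℝ → ℝ, Continuous f → IntervalIntegrable f volume 0 1 :=
    fun f hf => hf.intervalIntegrable _ _
  unfold taylorKernel
  split_ifs with h
  · simp only [mul_add, mul_sub]
    rw [intervalIntegral.integral_add (hc _ (by fun_prop)) (hc _ (by fun_prop)),
      intervalIntegral.integral_sub (hc _ (by fun_prop)) (hc _ (by fun_prop)),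
      integral_orderDensity_mul_id hk, intervalIntegral.integral_mul_const,
      integral_orderDensity hk, max_eq_left (by linarith)]
    ring
  · rw [max_eq_right (b := (0 : ℝ)) (by linarith)]
    simp

/-- Summing over the order statistics, the Peano kernels at their means are at most
half the Bernoulli variance. -/
theorem sum_integral_taylorKernel_le {n : ℕ} (hn : 1 ≤ n) {t : ℝ} (ht : t ∈ Set.Ioo (0 : ℝ) 1) :
    ∑ k ∈ Finset.range n,
      ∫ v in (0 : ℝ)..1, orderDensity n k v * taylorKernel v ((k + 1) / (n + 1)) t ≤
        t * (1 - t) / 2 := by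
  rw [Finset.sum_congr rfl fun k hk =>
    integral_orderDensity_mul_taylorKernel (Finset.mem_range.1 hk) t, Finset.sum_sub_distrib,
    ← intervalIntegral.integral_finsetSum fun k _ =>
      (by fun_prop : Continuous fun v => orderDensity n k v * max (t - v) 0).intervalIntegrable _ _]
  -- The averages of `(t - v)⁺` sum to `n t²/2`; the values at the means recover all of it but at
  -- most `t(1-t)/2`.
  simp only [← Finset.sum_mul, sum_orderDensity hn]
  rw [intervalIntegral.integral_const_mul, integral_max_sub ht]
  linarith [sum_max_sub_ge (n := n) ht]

/-! ### Mixed binomial laws against the mixing distribution function -/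

/-- Both sides are the probability that a `μ`-distributed point lies below an independent order
statistic; Fubini conditions on one or the other. Absence of atoms lets the strict inequality become
`≤`. -/
theorem integral_binomialCdf_eq (μ : Measure ℝ) [IsProbabilityMeasure μ] [NullSingletonClass μ]
    (hμ : μ.restrict (Set.Icc 0 1) = μ) {n k : ℕ} (hk : k < n) :
    ∫ t in Set.Icc (0 : ℝ) 1, binomialCdf n k t ∂μ =
      ∫ v in (0 : ℝ)..1, orderDensity n k v * cdf μ v := by
  have hS : MeasurableSet {q : ℝ × ℝ | q.1 < q.2} := measurableSet_lt measurable_fst measurable_snd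
  have hg : Integrable (orderDensity n k) (volume.restrict (Set.Ioc (0 : ℝ) 1)) :=
    ((continuous_orderDensity n k).integrableOn_Icc).mono_set Set.Ioc_subset_Icc_self
  have hint : Integrable (Function.uncurry fun t v =>
      {q : ℝ × ℝ | q.1 < q.2}.indicator (fun q => orderDensity n k q.2) (t, v))
      ((μ.restrict (Set.Icc 0 1)).prod (volume.restrict (Set.Ioc (0 : ℝ) 1))) :=
    (hg.comp_snd _).indicator hS
  calc ∫ t in Set.Icc (0 : ℝ) 1, binomialCdf n k t ∂μ
      = ∫ t in Set.Icc (0 : ℝ) 1, (∫ v in Set.Ioc (0 : ℝ) 1,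
          {q : ℝ × ℝ | q.1 < q.2}.indicator (fun q => orderDensity n k q.2) (t, v)) ∂μ := by
        refine setIntegral_congr_fun measurableSet_Icc fun t ht => ?_
        have h1 : ∀ v, {q : ℝ × ℝ | q.1 < q.2}.indicator (fun q => orderDensity n k q.2) (t, v) =
            (Set.Ioi t).indicator (orderDensity n k) v := fun v => by
          simp [Set.indicator]
        simp only [h1]
        rw [setIntegral_indicator measurableSet_Ioi, ← integral_orderDensity_Icc hk,
          intervalIntegral.integral_of_le ht.2]
        congr 2
        ext v
        simp only [Set.mem_Ioc, Set.mem_inter_iff, Set.mem_Ioi]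
        constructor
        · exact fun h => ⟨⟨lt_of_le_of_lt ht.1 h.1, h.2⟩, h.1⟩
        · exact fun h => ⟨h.2, h.1.2⟩
    _ = ∫ v in Set.Ioc (0 : ℝ) 1, ∫ t in Set.Icc (0 : ℝ) 1,
          {q : ℝ × ℝ | q.1 < q.2}.indicator (fun q => orderDensity n k q.2) (t, v) ∂μ :=
        integral_integral_swap hint
    _ = ∫ v in (0 : ℝ)..1, orderDensity n k v * cdf μ v := by
        rw [intervalIntegral.integral_of_le zero_le_one]
        refine setIntegral_congr_fun measurableSet_Ioc fun v _ => ?_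
        have h1 : ∀ t, {q : ℝ × ℝ | q.1 < q.2}.indicator (fun q => orderDensity n k q.2) (t, v) =
            (Set.Iio v).indicator (fun _ => orderDensity n k v) t := fun t => by
          simp [Set.indicator]
        simp only [h1]
        rw [hμ, integral_indicator measurableSet_Iio, setIntegral_const, cdf_eq_real, smul_eq_mul,
          mul_comm, measureReal_congr Iio_ae_eq_Iic]

/-- First order Taylor expansion of a distribution function with a differentiable density. -/
theorem enorm_cdf_sub_le (μ : Measure ℝ) {p p' : ℝ → ℝ}
    (hp : ∀ t ∈ Set.Ioo (0 : ℝ) 1, HasDerivAt p (p' t) t)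
    (hp' : ContinuousOn p' (Set.Ioo 0 1))
    (hF : ∀ m ∈ Set.Ioo (0 : ℝ) 1, ∀ v ∈ Set.Ioo (0 : ℝ) 1,
      cdf μ v - cdf μ m = ∫ t in m..v, p t)
    {m v : ℝ} (hm : m ∈ Set.Ioo (0 : ℝ) 1) (hv : v ∈ Set.Ioo (0 : ℝ) 1) :
    ‖cdf μ v - cdf μ m - p m * (v - m)‖ₑ ≤
      ∫⁻ t in Set.Ioo (0 : ℝ) 1, ‖p' t‖ₑ * ENNReal.ofReal (taylorKernel v m t) := by
  have hsub : Set.uIcc m v ⊆ Set.Ioo 0 1 := Set.ordConnected_Ioo.uIcc_subset hm hv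
  -- The antiderivative `t - v` of 1 vanishes at `v`, so the only boundary term is the linear Taylor
  -- term `p m * (v - m)`.
  have h1 := intervalIntegral.integral_mul_deriv_eq_deriv_mul (a := m) (b := v) (u := p) (u' := p')
    (v := fun t => t - v) (v' := fun _ => 1) (fun t ht => hp t (hsub ht))
    (fun t _ => (hasDerivAt_id' t).sub_const v) ((hp'.mono hsub).intervalIntegrable)
    (by simp)
  have h2 : cdf μ v - cdf μ m - p m * (v - m) = -∫ t in m..v, p' t * (t - v) := by
    rw [hF m hm v hv]
    simp only [mul_one, sub_self, mul_zero] at h1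
    rw [h1]
    ring
  rw [h2, enorm_neg]
  have h3 : ‖∫ t in m..v, p' t * (t - v)‖ₑ = ‖∫ t in Set.uIoc m v, p' t * (t - v)‖ₑ := by
    rw [← ofReal_norm, ← ofReal_norm,
      intervalIntegral.norm_intervalIntegral_eq]
  rw [h3]
  refine (enorm_integral_le_lintegral_enorm _).trans ?_
  calc ∫⁻ t in Set.uIoc m v, ‖p' t * (t - v)‖ₑ
      ≤ ∫⁻ t in Set.uIoc m v, ‖p' t‖ₑ * ENNReal.ofReal (taylorKernel v m t) := by
        refine setLIntegral_mono' measurableSet_uIoc fun t ht => ?_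
        rw [enorm_mul]
        gcongr
        rw [Real.enorm_eq_ofReal_abs]
        exact ENNReal.ofReal_le_ofReal (abs_sub_le_taylorKernel ht)
    _ ≤ _ := lintegral_mono_set (Set.uIoc_subset_uIcc.trans hsub)

theorem orderStatistic_mean_mem {n k : ℕ} (hk : k < n) :
    ((k : ℝ) + 1) / (n + 1) ∈ Set.Ioo (0 : ℝ) 1 := by
  have : (k : ℝ) < n := by exact_mod_cast hk
  exact ⟨by positivity, (div_lt_one (by positivity)).2 (by linarith)⟩

theorem intervalIntegrable_orderDensity_mul_taylorKernel (n k : ℕ) (m t : ℝ) :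
    IntervalIntegrable (fun v => orderDensity n k v * taylorKernel v m t) volume 0 1 := by
  refine Continuous.intervalIntegrable ?_ _ _
  unfold taylorKernel
  split_ifs <;> fun_prop

/-- The expansion point is the mean of the order statistic, so the linear Taylor term integrates to
zero. Extended nonnegative integrals avoid any integrability assumption on `p'`, which may blow up
at 0 and 1. -/
theorem enorm_integral_binomialCdf_sub_le (μ : Measure ℝ) [IsProbabilityMeasure μ]
    [NullSingletonClass μ] (hμ : μ.restrict (Set.Icc 0 1) = μ) {p p' : ℝ → ℝ}
    (hp : ∀ t ∈ Set.Ioo (0 : ℝ) 1, HasDerivAt p (p' t) t)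
    (hp' : ContinuousOn p' (Set.Ioo 0 1)) (hmeas : Measurable p')
    (hF : ∀ m ∈ Set.Ioo (0 : ℝ) 1, ∀ v ∈ Set.Ioo (0 : ℝ) 1,
      cdf μ v - cdf μ m = ∫ t in m..v, p t) {n k : ℕ} (hk : k < n) :
    ‖(∫ t in Set.Icc (0 : ℝ) 1, binomialCdf n k t ∂μ) - cdf μ ((k + 1) / (n + 1))‖ₑ ≤
      ∫⁻ t in Set.Ioo (0 : ℝ) 1, ‖p' t‖ₑ * ENNReal.ofReal
        (∫ v in (0 : ℝ)..1, orderDensity n k v * taylorKernel v ((k + 1) / (n + 1)) t) := by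
  set m : ℝ := ((k : ℝ) + 1) / (n + 1) with hm
  have hmI : m ∈ Set.Ioo (0 : ℝ) 1 := orderStatistic_mean_mem hk
  have hc : ∀ f : ℝ → ℝ, Continuous f → IntervalIntegrable f volume 0 1 :=
    fun f hf => hf.intervalIntegrable _ _
  have hgF : IntervalIntegrable (fun v => orderDensity n k v * cdf μ v) volume 0 1 :=
    (monotone_cdf μ).monotoneOn _ |>.intervalIntegrable.continuousOn_mul
      (continuous_orderDensity n k).continuousOn
  have h1 : (∫ t in Set.Icc (0 : ℝ) 1, binomialCdf n k t ∂μ) - cdf μ m =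
      ∫ v in Set.Ioo (0 : ℝ) 1, orderDensity n k v * (cdf μ v - cdf μ m - p m * (v - m)) := by
    rw [← integral_Ioc_eq_integral_Ioo, ← intervalIntegral.integral_of_le zero_le_one]
    have h2 : ∀ v, orderDensity n k v * (cdf μ v - cdf μ m - p m * (v - m)) =
        orderDensity n k v * cdf μ v - ((cdf μ m - p m * m) * orderDensity n k v
          + p m * (orderDensity n k v * v)) := fun v => by ring
    simp only [h2]
    rw [intervalIntegral.integral_sub hgF (hc _ (by fun_prop)),
      intervalIntegral.integral_add (hc _ (by fun_prop)) (hc _ (by fun_prop)),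
      intervalIntegral.integral_const_mul, intervalIntegral.integral_const_mul,
      integral_orderDensity hk, integral_orderDensity_mul_id hk,
      integral_binomialCdf_eq μ hμ hk]
    ring
  rw [h1]
  have hker : Measurable fun q : ℝ × ℝ => ENNReal.ofReal (orderDensity n k q.1) *
      (‖p' q.2‖ₑ * ENNReal.ofReal (taylorKernel q.1 m q.2)) := by
    have := measurable_taylorKernel m
    have := (continuous_orderDensity n k).measurable
    fun_prop
  calc ‖∫ v in Set.Ioo (0 : ℝ) 1, orderDensity n k v * (cdf μ v - cdf μ m - p m * (v - m))‖ₑ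
      ≤ ∫⁻ v in Set.Ioo (0 : ℝ) 1,
          ‖orderDensity n k v * (cdf μ v - cdf μ m - p m * (v - m))‖ₑ :=
        enorm_integral_le_lintegral_enorm _
    _ ≤ ∫⁻ v in Set.Ioo (0 : ℝ) 1, ∫⁻ t in Set.Ioo (0 : ℝ) 1,
          ENNReal.ofReal (orderDensity n k v) *
            (‖p' t‖ₑ * ENNReal.ofReal (taylorKernel v m t)) := by
        refine setLIntegral_mono' measurableSet_Ioo fun v hv => ?_
        rw [lintegral_const_mul' _ _ ENNReal.ofReal_ne_top, enorm_mul,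
          Real.enorm_of_nonneg (orderDensity_nonneg n k (Set.Ioo_subset_Icc_self hv))]
        gcongr
        exact enorm_cdf_sub_le μ hp hp' hF hmI hv
    _ = ∫⁻ t in Set.Ioo (0 : ℝ) 1, ∫⁻ v in Set.Ioo (0 : ℝ) 1,
          ENNReal.ofReal (orderDensity n k v) *
            (‖p' t‖ₑ * ENNReal.ofReal (taylorKernel v m t)) :=
        lintegral_lintegral_swap hker.aemeasurable
    _ = _ := by
        refine lintegral_congr fun t => ?_
        have h3 := intervalIntegrable_orderDensity_mul_taylorKernel n k m t
        rw [intervalIntegral.integral_of_le zero_le_one, integral_Ioc_eq_integral_Ioo,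
          ofReal_integral_eq_lintegral_ofReal
            (((intervalIntegrable_iff_integrableOn_Ioo_of_le zero_le_one).1 h3))
            ((ae_restrict_iff' measurableSet_Ioo).2 (Filter.Eventually.of_forall fun v hv =>
              mul_nonneg (orderDensity_nonneg n k (Set.Ioo_subset_Icc_self hv))
                (taylorKernel_nonneg v m t))),
          ← lintegral_const_mul' _ _ enorm_ne_top]
        refine setLIntegral_congr_fun measurableSet_Ioo fun v hv => ?_
        rw [ENNReal.ofReal_mul (orderDensity_nonneg n k (Set.Ioo_subset_Icc_self hv))]
        ring

theorem sum_enorm_integral_binomialCdf_sub_le (μ : Measure ℝ) [IsProbabilityMeasure μ]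
    [NullSingletonClass μ] (hμ : μ.restrict (Set.Icc 0 1) = μ) {p p' : ℝ → ℝ}
    (hp : ∀ t ∈ Set.Ioo (0 : ℝ) 1, HasDerivAt p (p' t) t)
    (hp' : ContinuousOn p' (Set.Ioo 0 1)) (hmeas : Measurable p')
    (hF : ∀ m ∈ Set.Ioo (0 : ℝ) 1, ∀ v ∈ Set.Ioo (0 : ℝ) 1,
      cdf μ v - cdf μ m = ∫ t in m..v, p t) {n : ℕ} (hn : 1 ≤ n) :
    ∑ k ∈ Finset.range n,
      ‖(∫ t in Set.Icc (0 : ℝ) 1, binomialCdf n k t ∂μ) - cdf μ ((k + 1) / (n + 1))‖ₑ ≤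
      ∫⁻ t in Set.Ioo (0 : ℝ) 1, ‖p' t‖ₑ * ENNReal.ofReal (t * (1 - t) / 2) := by
  refine (Finset.sum_le_sum fun k hk => enorm_integral_binomialCdf_sub_le μ hμ hp hp' hmeas hF
    (Finset.mem_range.1 hk)).trans ?_
  have hI : ∀ k t, 0 ≤
      ∫ v in (0 : ℝ)..1, orderDensity n k v * taylorKernel v ((k + 1) / (n + 1)) t :=
    fun k t => intervalIntegral.integral_nonneg zero_le_one fun v hv =>
      mul_nonneg (orderDensity_nonneg n k hv) (taylorKernel_nonneg _ _ _)
  have hm : ∀ k, Measurable fun t => ‖p' t‖ₑ * ENNReal.ofReal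
        (∫ v in (0 : ℝ)..1, orderDensity n k v * taylorKernel v ((k + 1) / (n + 1)) t) := by
    intro k
    refine hmeas.enorm.mul (ENNReal.measurable_ofReal.comp ?_)
    simp only [intervalIntegral.integral_of_le zero_le_one]
    have h : StronglyMeasurable fun q : ℝ × ℝ =>
        orderDensity n k q.2 * taylorKernel q.2 ((k + 1) / (n + 1)) q.1 := by
      refine Measurable.stronglyMeasurable (Measurable.mul ?_ ?_)
      · exact (continuous_orderDensity n k).measurable.comp measurable_snd
      · exact (measurable_taylorKernel _).comp measurable_swap
    exact h.integral_prod_right.measurable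
  rw [← lintegral_finsetSum _ fun k _ => hm k]
  refine setLIntegral_mono' measurableSet_Ioo fun t ht => ?_
  rw [← Finset.mul_sum, ← ENNReal.ofReal_sum_of_nonneg fun k _ => hI k t]
  gcongr
  exact sum_integral_taylorKernel_le hn ht

/-! ### The Beta law and its density -/

theorem intervalIntegrable_rpow_mul_rpow {α β : ℝ} (hα : 0 < α) (hβ : 0 < β) :
    IntervalIntegrable (fun t : ℝ => t ^ (α - 1) * (1 - t) ^ (β - 1)) volume 0 1 := by
  have h := (Complex.betaIntegral_convergent (u := α) (v := β) (by simpa) (by simpa)).norm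
  refine h.congr fun t ht => ?_
  rw [Set.uIoc_of_le zero_le_one] at ht
  have h1 : (0 : ℝ) ≤ 1 - t := by linarith [ht.2]
  have h2 : (t : ℂ) ^ ((α : ℂ) - 1) * (1 - t) ^ ((β : ℂ) - 1) =
      ((t ^ (α - 1) * (1 - t) ^ (β - 1) : ℝ) : ℂ) := by
    push_cast [Complex.ofReal_cpow ht.1.le, Complex.ofReal_cpow h1]
    rfl
  simp only [h2]
  rw [Complex.norm_real, Real.norm_of_nonneg]
  exact mul_nonneg (Real.rpow_nonneg ht.1.le _) (Real.rpow_nonneg h1 _)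

theorem intervalIntegrable_rpow_mul_rpow_of_mem {α β : ℝ} (hα : 0 < α) (hβ : 0 < β) {x y : ℝ}
    (hx : x ∈ Set.Icc (0 : ℝ) 1) (hy : y ∈ Set.Icc (0 : ℝ) 1) :
    IntervalIntegrable (fun t : ℝ => t ^ (α - 1) * (1 - t) ^ (β - 1)) volume x y := by
  refine (intervalIntegrable_rpow_mul_rpow hα hβ).mono_set ?_
  rw [Set.uIcc_of_le zero_le_one]
  exact Set.ordConnected_Icc.uIcc_subset hx hy

theorem betaPDFReal_nonneg {α β : ℝ} (hα : 0 < α) (hβ : 0 < β) (t : ℝ) :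
    0 ≤ betaPDFReal α β t := by
  by_cases h : 0 < t ∧ t < 1
  · exact (betaPDFReal_pos h.1 h.2 hα hβ).le
  · rw [betaPDFReal, if_neg h]

theorem measurable_betaPDF (α β : ℝ) : Measurable (betaPDF α β) :=
  ENNReal.measurable_ofReal.comp (measurable_betaPDFReal α β)

theorem integral_betaMeasure {α β : ℝ} (hα : 0 < α) (hβ : 0 < β) (f : ℝ → ℝ) :
    ∫ t, f t ∂betaMeasure α β =
      (∫ t in (0 : ℝ)..1, t ^ (α - 1) * (1 - t) ^ (β - 1) * f t) / beta α β := by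
  rw [betaMeasure, integral_withDensity_eq_integral_toReal_smul (measurable_betaPDF α β)
    (Filter.Eventually.of_forall fun t => ENNReal.ofReal_lt_top),
    intervalIntegral.integral_of_le zero_le_one, integral_Ioc_eq_integral_Ioo,
    ← integral_div, ← integral_indicator measurableSet_Ioo]
  refine integral_congr_ae (Filter.Eventually.of_forall fun t => ?_)
  simp only [betaPDF, ENNReal.toReal_ofReal (betaPDFReal_nonneg hα hβ t)]
  simp only [betaPDFReal, Set.indicator, Set.mem_Ioo, smul_eq_mul]
  split_ifs
  · ring
  · simp

theorem ae_mem_Ioo_betaMeasure (α β : ℝ) : ∀ᵐ t ∂betaMeasure α β, t ∈ Set.Ioo (0 : ℝ) 1 := by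
  rw [betaMeasure, ae_withDensity_iff (measurable_betaPDF α β)]
  refine Filter.Eventually.of_forall fun t ht => ?_
  by_contra h
  rw [Set.mem_Ioo] at h
  exact ht (by rw [betaPDF_eq, if_neg h, ENNReal.ofReal_zero])

theorem betaMeasure_restrict_Icc (α β : ℝ) :
    (betaMeasure α β).restrict (Set.Icc 0 1) = betaMeasure α β :=
  Measure.restrict_eq_self_of_ae_mem
    ((ae_mem_Ioo_betaMeasure α β).mono fun _ h => Set.Ioo_subset_Icc_self h)

instance nullSingletonClass_betaMeasure (α β : ℝ) : NullSingletonClass (betaMeasure α β) := by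
  unfold betaMeasure
  infer_instance

theorem cdf_betaMeasure_sub {α β : ℝ} (hα : 0 < α) (hβ : 0 < β) (m v : ℝ) :
    cdf (betaMeasure α β) v - cdf (betaMeasure α β) m = ∫ t in m..v, betaPDFReal α β t := by
  have := isProbabilityMeasureBeta hα hβ
  have key : ∀ m v : ℝ, m ≤ v → cdf (betaMeasure α β) v - cdf (betaMeasure α β) m =
      ∫ t in m..v, betaPDFReal α β t := by
    intro m v h
    have h1 : (betaMeasure α β).real (Set.Ioc m v) = ∫ t in Set.Ioc m v, betaPDFReal α β t := by
      have h2 := setIntegral_withDensity_eq_setIntegral_toReal_smul (μ := volume)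
        (measurable_betaPDF α β) (Filter.Eventually.of_forall fun t => ENNReal.ofReal_lt_top)
        (fun _ => (1 : ℝ)) (measurableSet_Ioc (a := m) (b := v))
      rw [← betaMeasure, setIntegral_const, smul_eq_mul, mul_one] at h2
      rw [h2]
      refine setIntegral_congr_fun measurableSet_Ioc fun t _ => ?_
      simp [betaPDF, betaPDFReal_nonneg hα hβ t]
    rw [intervalIntegral.integral_of_le h, ← h1, cdf_eq_real, cdf_eq_real,
      ← Set.Iic_sdiff_Iic, measureReal_sdiff (Set.Iic_subset_Iic.2 h) measurableSet_Iic]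
  rcases le_total m v with h | h
  · exact key m v h
  · rw [intervalIntegral.integral_symm, ← key v m h]
    ring

/-- The derivative of the Beta density. -/
noncomputable def betaPDFDeriv (α β t : ℝ) : ℝ :=
  betaPDFReal α β t * ((α - 1) / t - (β - 1) / (1 - t))

theorem measurable_betaPDFDeriv (α β : ℝ) : Measurable (betaPDFDeriv α β) := by
  unfold betaPDFDeriv
  fun_prop

theorem hasDerivAt_betaPDFReal (α β : ℝ) {t : ℝ} (ht : t ∈ Set.Ioo (0 : ℝ) 1) :
    HasDerivAt (betaPDFReal α β) (betaPDFDeriv α β t) t := by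
  have h0 : t ≠ 0 := ht.1.ne'
  have h1 : 1 - t ≠ 0 := by linarith [ht.2]
  have ha : HasDerivAt (fun s : ℝ => s ^ (α - 1)) ((α - 1) * t ^ (α - 1 - 1)) t :=
    Real.hasDerivAt_rpow_const (Or.inl h0)
  have hb : HasDerivAt (fun s : ℝ => (1 - s) ^ (β - 1)) (-1 * (β - 1) * (1 - t) ^ (β - 1 - 1)) t :=
    ((hasDerivAt_id' t).const_sub 1).rpow_const (Or.inl h1)
  have heq : betaPDFReal α β =ᶠ[nhds t]
      fun s => 1 / beta α β * s ^ (α - 1) * (1 - s) ^ (β - 1) := by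
    filter_upwards [Ioo_mem_nhds ht.1 ht.2] with s hs
    rw [Set.mem_Ioo] at hs
    rw [betaPDFReal, if_pos hs]
  refine (((ha.const_mul (1 / beta α β)).fun_mul hb).congr_of_eventuallyEq heq).congr_deriv ?_
  rw [betaPDFDeriv, betaPDFReal, if_pos (by simpa using ht), Real.rpow_sub_one h0 (α - 1),
    Real.rpow_sub_one h1 (β - 1)]
  field_simp
  ring

theorem continuousOn_betaPDFDeriv (α β : ℝ) :
    ContinuousOn (betaPDFDeriv α β) (Set.Ioo 0 1) := by
  have h : ContinuousOn (betaPDFReal α β) (Set.Ioo 0 1) := fun t ht =>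
    (hasDerivAt_betaPDFReal α β ht).continuousAt.continuousWithinAt
  refine h.mul (ContinuousOn.sub ?_ ?_)
  · exact continuousOn_const.div continuousOn_id fun t ht => ht.1.ne'
  · exact continuousOn_const.div (by fun_prop) fun t ht => (by linarith [ht.2] : 1 - t ≠ 0)

/-- Multiplying the logarithmic derivative `(α-1)/t - (β-1)/(1-t)` by `t(1-t)` leaves an affine
function, so the weighted integral is an absolute moment of the Beta law. -/
theorem lintegral_betaPDFDeriv {α β : ℝ} (hα : 0 < α) (hβ : 0 < β) :
    ∫⁻ t in Set.Ioo (0 : ℝ) 1, ‖betaPDFDeriv α β t‖ₑ * ENNReal.ofReal (t * (1 - t) / 2) =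
      ENNReal.ofReal ((∫ t, |(α + β - 2) * t + (1 - α)| ∂betaMeasure α β) / 2) := by
  have := isProbabilityMeasureBeta hα hβ
  have hint : Integrable (fun t => |(α + β - 2) * t + (1 - α)| / 2) (betaMeasure α β) := by
    refine Integrable.of_bound (C := (|α + β - 2| + |1 - α|) / 2)
      (by fun_prop) ?_
    filter_upwards [ae_mem_Ioo_betaMeasure α β] with t ht
    rw [Real.norm_of_nonneg (by positivity)]
    have h1 := abs_add_le ((α + β - 2) * t) (1 - α)
    have h2 : |(α + β - 2) * t| ≤ |α + β - 2| := by
      rw [abs_mul, abs_of_pos ht.1]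
      exact mul_le_of_le_one_right (abs_nonneg _) ht.2.le
    linarith
  rw [← integral_div, ofReal_integral_eq_lintegral_ofReal hint
    (Filter.Eventually.of_forall fun t => by positivity), betaMeasure,
    lintegral_withDensity_eq_lintegral_mul _ (measurable_betaPDF α β) (by fun_prop),
    ← lintegral_indicator measurableSet_Ioo]
  refine lintegral_congr fun t => ?_
  by_cases ht : t ∈ Set.Ioo (0 : ℝ) 1
  · have h0 : t ≠ 0 := ht.1.ne'
    have h1 : 1 - t ≠ 0 := by linarith [ht.2]
    have h1' : 0 < 1 - t := by linarith [ht.2]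
    have hp := betaPDFReal_nonneg hα hβ t
    rw [Set.indicator_of_mem ht, Pi.mul_apply, betaPDF, Real.enorm_eq_ofReal_abs,
      ← ENNReal.ofReal_mul (abs_nonneg _), ← ENNReal.ofReal_mul hp, betaPDFDeriv, abs_mul,
      abs_of_nonneg hp]
    congr 1
    have h2 : (α + β - 2) * t + (1 - α) = -(((α - 1) / t - (β - 1) / (1 - t)) * (t * (1 - t))) := by
      field_simp
      ring
    rw [h2, abs_neg, abs_mul, abs_of_pos (mul_pos ht.1 h1')]
    ring
  · rw [Set.indicator_of_notMem ht, Pi.mul_apply, betaPDF_eq, if_neg (by rwa [Set.mem_Ioo] at ht)]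
    simp

/-! ### Absolute moments of affine functions under the Beta law -/

theorem integral_rpow_mul_rpow_mul_affine {α β : ℝ} (hα : 0 < α) (hβ : 0 < β) {x : ℝ}
    (hx : x ∈ Set.Icc (0 : ℝ) 1) (a b : ℝ) :
    ∫ t in (0 : ℝ)..x, t ^ (α - 1) * (1 - t) ^ (β - 1) * (a * t + b) =
      a * incompleteBeta x (α + 1) β + b * incompleteBeta x α β := by
  have h0 : (0 : ℝ) ∈ Set.Icc (0 : ℝ) 1 := by simp
  have h1 := intervalIntegrable_rpow_mul_rpow_of_mem (α := α + 1) (by positivity) hβ h0 hx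
  have h2 := intervalIntegrable_rpow_mul_rpow_of_mem hα hβ h0 hx
  rw [incompleteBeta, incompleteBeta, ← intervalIntegral.integral_const_mul,
    ← intervalIntegral.integral_const_mul,
    ← intervalIntegral.integral_add (h1.const_mul a) (h2.const_mul b)]
  refine intervalIntegral.integral_congr fun t ht => ?_
  rw [Set.uIcc_of_le hx.1] at ht
  have h3 : t ^ (α + 1 - 1) = t ^ (α - 1) * t := by
    -- At `t = 0` the exponent rule is not available, but `α > 0` makes both sides zero.
    rcases ht.1.eq_or_lt with h | h
    · rw [← h, mul_zero, Real.zero_rpow (by linarith)]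
    · rw [← Real.rpow_add_one h.ne']
      congr 1
      ring
  simp only [h3]
  ring

theorem integral_abs_affine_betaMeasure_of_pos {α β : ℝ} (hα : 0 < α) (hβ : 0 < β) {a : ℝ}
    (ha : 0 < a) (b : ℝ) :
    ∫ t, |a * t + b| ∂betaMeasure α β = betaAbsMomentPos α β a b := by
  have hone : (1 : ℝ) ∈ Set.Icc (0 : ℝ) 1 := by simp
  have hfull := integral_rpow_mul_rpow_mul_affine hα hβ hone a b
  rw [← beta_eq_incompleteBeta_one (by positivity) hβ, ← beta_eq_incompleteBeta_one hα hβ] at hfull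
  rw [integral_betaMeasure hα hβ, betaAbsMomentPos]
  split_ifs with h1 h2
  · rw [← hfull]
    congr 1
    refine intervalIntegral.integral_congr fun t ht => ?_
    rw [Set.uIcc_of_le zero_le_one] at ht
    rw [abs_of_nonneg (by nlinarith [ht.1])]
  · rw [← hfull, ← neg_div, ← intervalIntegral.integral_neg]
    congr 1
    refine intervalIntegral.integral_congr fun t ht => ?_
    rw [Set.uIcc_of_le zero_le_one] at ht
    rw [abs_of_nonpos (by nlinarith [ht.2])]
    ring
  · have hc0 : 0 ≤ -b / a := div_nonneg (by linarith) ha.le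
    have hc1 : -b / a ≤ 1 := (div_le_one ha).2 (by linarith)
    have hcI : -b / a ∈ Set.Icc (0 : ℝ) 1 := ⟨hc0, hc1⟩
    have hpart := integral_rpow_mul_rpow_mul_affine hα hβ hcI a b
    have hac : a * (-b / a) = -b := by field_simp
    set c := -b / a with hc
    have hw : ∀ x ∈ Set.Icc (0 : ℝ) 1, ∀ y ∈ Set.Icc (0 : ℝ) 1, ∀ f : ℝ → ℝ, Continuous f →
        IntervalIntegrable (fun t : ℝ => t ^ (α - 1) * (1 - t) ^ (β - 1) * f t) volume x y :=
      fun x hx y hy f hf =>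
        (intervalIntegrable_rpow_mul_rpow_of_mem hα hβ hx hy).mul_continuousOn hf.continuousOn
    have h0 : (0 : ℝ) ∈ Set.Icc (0 : ℝ) 1 := by simp
    -- The affine function changes sign at `c = -b/a`. Its absolute value therefore integrates to
    -- the full integral minus twice the part over `[0, c]`.
    have hsplit1 := intervalIntegral.integral_add_adjacent_intervals
      (hw 0 h0 c hcI (fun t => |a * t + b|) (by fun_prop))
      (hw c hcI 1 hone (fun t => |a * t + b|) (by fun_prop))
    have hsplit2 := intervalIntegral.integral_add_adjacent_intervals
      (hw 0 h0 c hcI (fun t => a * t + b) (by fun_prop))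
      (hw c hcI 1 hone (fun t => a * t + b) (by fun_prop))
    have hl : ∫ t in (0 : ℝ)..c, t ^ (α - 1) * (1 - t) ^ (β - 1) * |a * t + b| =
        -∫ t in (0 : ℝ)..c, t ^ (α - 1) * (1 - t) ^ (β - 1) * (a * t + b) := by
      rw [← intervalIntegral.integral_neg]
      refine intervalIntegral.integral_congr fun t ht => ?_
      rw [Set.uIcc_of_le hc0] at ht
      rw [abs_of_nonpos (by nlinarith [ht.2])]
      ring
    have hr : ∫ t in c..1, t ^ (α - 1) * (1 - t) ^ (β - 1) * |a * t + b| =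
        ∫ t in c..1, t ^ (α - 1) * (1 - t) ^ (β - 1) * (a * t + b) := by
      refine intervalIntegral.integral_congr fun t ht => ?_
      rw [Set.uIcc_of_le hc1] at ht
      rw [abs_of_nonneg (by nlinarith [ht.1])]
    congr 1
    linarith

theorem integral_abs_affine_betaMeasure {α β : ℝ} (hα : 0 < α) (hβ : 0 < β) (a b : ℝ) :
    ∫ t, |a * t + b| ∂betaMeasure α β = betaAbsMoment α β a b := by
  have := isProbabilityMeasureBeta hα hβ
  rw [betaAbsMoment]
  split_ifs with h1 h2
  · exact integral_abs_affine_betaMeasure_of_pos hα hβ h1 b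
  · simp [h2]
  · rw [← integral_abs_affine_betaMeasure_of_pos hα hβ
      (neg_pos.2 (lt_of_le_of_ne (not_lt.1 h1) h2))]
    refine integral_congr_ae (Filter.Eventually.of_forall fun t => ?_)
    simp only
    rw [← abs_neg]
    congr 1
    ring

theorem betaAbsMoment_nonneg {α β : ℝ} (hα : 0 < α) (hβ : 0 < β) (a b : ℝ) :
    0 ≤ betaAbsMoment α β a b := by
  rw [← integral_abs_affine_betaMeasure hα hβ]
  exact integral_nonneg fun t => abs_nonneg _

/-! ### Beta recurrences and comparison of constants -/

theorem beta_add_one_left {α β : ℝ} (hα : 0 < α) (hβ : 0 < β) :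
    beta (α + 1) β = α / (α + β) * beta α β := by
  have h := (Real.Gamma_pos_of_pos (add_pos hα hβ)).ne'
  have h2 : α + β ≠ 0 := (add_pos hα hβ).ne'
  rw [beta, beta, Real.Gamma_add_one hα.ne', show α + 1 + β = α + β + 1 by ring,
    Real.Gamma_add_one h2]
  field_simp

theorem beta_comm (α β : ℝ) : beta α β = beta β α := by
  rw [beta, beta, mul_comm, add_comm]

theorem beta_add_one_right {α β : ℝ} (hα : 0 < α) (hβ : 0 < β) :
    beta α (β + 1) = β / (α + β) * beta α β := by
  rw [beta_comm, beta_add_one_left hβ hα, beta_comm, add_comm]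

/-- The quotient is `E[θ² + (1-θ)²]`, and `x² + (1-x)² ≥ 1/2`. The recurrences make the excess
explicit. -/
theorem half_le_beta_add_two {α β : ℝ} (hα : 0 < α) (hβ : 0 < β) :
    1 / 2 ≤ (beta (α + 2) β + beta α (β + 2)) / beta α β := by
  have h1 : beta (α + 2) β = (α + 1) / (α + 1 + β) * (α / (α + β) * beta α β) := by
    rw [← beta_add_one_left hα hβ, ← beta_add_one_left (by positivity) hβ]
    congr 1
    ring
  have h2 : beta α (β + 2) = (β + 1) / (α + (β + 1)) * (β / (α + β) * beta α β) := by
    rw [← beta_add_one_right hα hβ, ← beta_add_one_right hα (by positivity)]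
    congr 1
    ring
  have hB := beta_pos hα hβ
  rw [le_div_iff₀ hB, h1, h2, show α + (β + 1) = α + 1 + β by ring]
  have h3 : (α + 1) / (α + 1 + β) * (α / (α + β) * beta α β) +
      (β + 1) / (α + 1 + β) * (β / (α + β) * beta α β) - 1 / 2 * beta α β =
      ((α - β) ^ 2 + α + β) / (2 * (α + 1 + β) * (α + β)) * beta α β := by
    field_simp
    ring
  have h4 : 0 ≤ ((α - β) ^ 2 + α + β) / (2 * (α + 1 + β) * (α + β)) * beta α β := by positivity
  linarith

/-- The first and last terms of `betaConst` are each at least `1/2` and pay for the 1; the last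
because `2πe ≤ 36`. -/
theorem one_add_half_betaAbsMoment_le_betaConst {α β : ℝ} (hα : 0 < α) (hβ : 0 < β) :
    1 + betaAbsMoment α β (α + β - 2) (1 - α) / 2 ≤ betaConst α β := by
  have h1 := half_le_beta_add_two hα hβ
  have h2 := betaAbsMoment_nonneg hα hβ 2 (-1)
  have h3 := betaAbsMoment_nonneg hα hβ (α + β - 2) (1 - α)
  have h4 : 1 / 2 ≤ 3 / Real.sqrt (2 * Real.pi * Real.exp 1) := by
    have hpos : 0 < Real.sqrt (2 * Real.pi * Real.exp 1) :=
      Real.sqrt_pos.2 (by positivity)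
    rw [div_le_div_iff₀ two_pos hpos]
    have : Real.sqrt (2 * Real.pi * Real.exp 1) ≤ 6 := by
      refine Real.sqrt_le_iff.2 ⟨by norm_num, ?_⟩
      have hpi := Real.pi_lt_d2
      have he := Real.exp_one_lt_d9
      nlinarith [Real.pi_pos, Real.exp_pos 1]
    linarith
  unfold betaConst
  linarith

/-! ### The empirical mean of a mixture of Bernoulli sequences -/

theorem measurableSet_historyEvent {Ω : Type*} [MeasurableSpace Ω] {X : ℕ → Ω → ℕ}
    (hX : IsZeroOneSequence X) {n : ℕ} (e : Fin n → ℕ) : MeasurableSet (historyEvent X e) := by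
  have h : historyEvent X e = ⋂ i : Fin n, X i ⁻¹' {e i} := by
    ext ω
    simp [historyEvent]
  rw [h]
  exact MeasurableSet.iInter fun i => hX.measurable i (measurableSet_singleton _)

/-- A history is indexed by the set of times at which it equals 1. The mixing formula gives all
histories with `j` ones the same probability, whence the binomial coefficient. -/
theorem sum_range_eq_iff_exists_history {Ω : Type*} [MeasurableSpace Ω] {X : ℕ → Ω → ℕ}
    (hX : IsZeroOneSequence X) (n j : ℕ) :
    {ω | ∑ i ∈ Finset.range n, X i ω = j} =
      ⋃ s ∈ Finset.powersetCard j (Finset.univ : Finset (Fin n)),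
        historyEvent X fun i => if i ∈ s then 1 else 0 := by
  ext ω
  simp only [Set.mem_ofPred_eq, Set.mem_iUnion, Finset.mem_powersetCard_univ, historyEvent,
    exists_prop, ← Fin.sum_univ_eq_sum_range (fun i => X i ω)]
  constructor
  · intro h
    have hv : ∀ i : Fin n, X i ω = if X i ω = 1 then 1 else 0 := fun i => by
      rcases hX.zero_or_one i ω with h | h <;> simp [h]
    refine ⟨Finset.univ.filter fun i : Fin n => X i ω = 1, ?_, fun i => ?_⟩
    · rw [Finset.card_filter, ← h]
      exact Finset.sum_congr rfl fun i _ => (hv i).symm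
    · simpa using hv i
  · rintro ⟨s, hs, h⟩
    rw [Finset.sum_congr rfl fun i _ => h i]
    simpa using hs

theorem HasMixingMeasure.measureReal_sum_eq {Ω : Type*} [MeasurableSpace Ω] {P : Measure Ω}
    [IsProbabilityMeasure P] {X : ℕ → Ω → ℕ} {μ : Measure ℝ} (hX : HasMixingMeasure P X μ)
    (n j : ℕ) :
    P.real {ω | ∑ i ∈ Finset.range n, X i ω = j} =
      ∫ t in Set.Icc (0 : ℝ) 1, (bernsteinPolynomial ℝ n j).eval t ∂μ := by
  rw [sum_range_eq_iff_exists_history hX.toIsZeroOneSequence, measureReal_biUnion_finset]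
  · have h : ∀ s ∈ Finset.powersetCard j (Finset.univ : Finset (Fin n)),
        P.real (historyEvent X fun i => if i ∈ s then 1 else 0) =
          ∫ t in Set.Icc (0 : ℝ) 1, t ^ j * (1 - t) ^ (n - j) ∂μ := by
      intro s hs
      rw [hX.prob_history n _ fun i => by by_cases h : i ∈ s <;> simp [h]]
      simp [Finset.mem_powersetCard_univ.1 hs]
    rw [Finset.sum_congr rfl h]
    simp [bernsteinPolynomial_eval, mul_assoc, integral_const_mul]
  · intro s _ s' _ hss'
    refine Set.disjoint_left.2 fun ω h h' => hss' ?_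
    ext i
    have h1 : (if i ∈ s then 1 else 0) = if i ∈ s' then 1 else 0 := (h i).symm.trans (h' i)
    by_cases hi : i ∈ s <;> by_cases hi' : i ∈ s' <;> simp [hi, hi'] at h1 ⊢
  · exact fun s _ => measurableSet_historyEvent hX.toIsZeroOneSequence _

theorem IsZeroOneSequence.measurable_sum {Ω : Type*} [MeasurableSpace Ω] {X : ℕ → Ω → ℕ}
    (hX : IsZeroOneSequence X) (n : ℕ) : Measurable fun ω => ∑ i ∈ Finset.range n, X i ω :=
  Finset.measurable_fun_sum _ fun i _ => hX.measurable i

theorem HasMixingMeasure.measureReal_sum_le {Ω : Type*} [MeasurableSpace Ω] {P : Measure Ω}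
    [IsProbabilityMeasure P] {X : ℕ → Ω → ℕ} {μ : Measure ℝ} [IsFiniteMeasure μ]
    (hX : HasMixingMeasure P X μ) (n k : ℕ) :
    P.real {ω | ∑ i ∈ Finset.range n, X i ω ≤ k} =
      ∫ t in Set.Icc (0 : ℝ) 1, binomialCdf n k t ∂μ := by
  have h : {ω | ∑ i ∈ Finset.range n, X i ω ≤ k} =
      ⋃ j ∈ Finset.range (k + 1), {ω | ∑ i ∈ Finset.range n, X i ω = j} := by
    ext ω
    simp
  rw [h, measureReal_biUnion_finset]
  · unfold binomialCdf
    rw [integral_finsetSum _ fun j _ => ?_]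
    · exact Finset.sum_congr rfl fun j _ => hX.measureReal_sum_eq n j
    · exact (Polynomial.continuous _).integrableOn_Icc
  · intro j _ j' _ hjj'
    exact Set.disjoint_left.2 fun ω h h' => hjj' (h.symm.trans h')
  · exact fun j _ => hX.toIsZeroOneSequence.measurable_sum n (measurableSet_singleton j)

theorem IsZeroOneSequence.measurable_empiricalMean {Ω : Type*} [MeasurableSpace Ω]
    {X : ℕ → Ω → ℕ} (hX : IsZeroOneSequence X) (n : ℕ) : Measurable (empiricalMean X n) := by
  unfold empiricalMean
  refine Measurable.div_const (Finset.measurable_fun_sum _ fun i _ => ?_) _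
  exact measurable_from_nat.comp (hX.measurable i)

theorem IsZeroOneSequence.empiricalMean_mem {Ω : Type*} [MeasurableSpace Ω]
    {X : ℕ → Ω → ℕ} (hX : IsZeroOneSequence X) (n : ℕ) (ω : Ω) :
    empiricalMean X n ω ∈ Set.Icc (0 : ℝ) 1 := by
  refine ⟨div_nonneg (Finset.sum_nonneg fun i _ => Nat.cast_nonneg _) (Nat.cast_nonneg _),
    div_le_one_of_le₀ ?_ (Nat.cast_nonneg _)⟩
  calc ∑ i ∈ Finset.range n, (X i ω : ℝ) ≤ ∑ i ∈ Finset.range n, (1 : ℝ) :=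
        Finset.sum_le_sum fun i _ => by rcases hX.zero_or_one i ω with h | h <;> simp [h]
    _ = n := by simp

theorem HasMixingMeasure.cdf_empiricalMean {Ω : Type*} [MeasurableSpace Ω] {P : Measure Ω}
    [IsProbabilityMeasure P] {X : ℕ → Ω → ℕ} {μ : Measure ℝ} [IsFiniteMeasure μ]
    (hX : HasMixingMeasure P X μ) {n : ℕ} (hn : 1 ≤ n) (k : ℕ) {x : ℝ}
    (hx : x ∈ Set.Ico ((k : ℝ) / n) ((k + 1) / n)) :
    cdf (P.map (empiricalMean X n)) x = ∫ t in Set.Icc (0 : ℝ) 1, binomialCdf n k t ∂μ := by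
  have hmeas := hX.toIsZeroOneSequence.measurable_empiricalMean n
  have := Measure.isProbabilityMeasure_map (μ := P) hmeas.aemeasurable
  have hn0 : (0 : ℝ) < n := by exact_mod_cast hn
  rw [cdf_eq_real, map_measureReal_apply hmeas measurableSet_Iic, ← hX.measureReal_sum_le]
  congr 1
  ext ω
  simp only [Set.mem_preimage, Set.mem_Iic, empiricalMean, Set.mem_ofPred_eq]
  have hcast : ∑ i ∈ Finset.range n, (X i ω : ℝ) = ((∑ i ∈ Finset.range n, X i ω : ℕ) : ℝ) := by
    push_cast
    rfl
  rw [hcast]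
  constructor
  · intro h
    have h1 := (div_lt_div_iff_of_pos_right hn0).1 (h.trans_lt hx.2)
    exact Nat.lt_succ_iff.1 (by exact_mod_cast h1)
  · intro h
    refine le_trans ?_ hx.1
    gcongr

theorem cdf_of_neg {ρ : Measure ℝ} [IsProbabilityMeasure ρ]
    (hρ : ∀ᵐ y ∂ρ, y ∈ Set.Icc (0 : ℝ) 1) {x : ℝ} (hx : x < 0) : cdf ρ x = 0 := by
  rw [cdf_eq_real, measureReal_eq_zero_iff]
  refine measure_mono_null (fun y hy => ?_) (mem_ae_iff.1 hρ)
  exact fun h => absurd (h.1.trans hy) (not_le.2 hx)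

theorem cdf_of_one_le {ρ : Measure ℝ} [IsProbabilityMeasure ρ]
    (hρ : ∀ᵐ y ∂ρ, y ∈ Set.Icc (0 : ℝ) 1) {x : ℝ} (hx : 1 ≤ x) : cdf ρ x = 1 := by
  rw [cdf_eq_real, measureReal_def, ENNReal.toReal_eq_one_iff,
    ← mem_ae_iff_prob_eq_one measurableSet_Iic]
  refine hρ.mono fun y hy => ?_
  exact hy.2.trans hx

theorem orderStatistic_mean_mem_Icc {n k : ℕ} (hk : k < n) :
    ((k : ℝ) + 1) / (n + 1) ∈ Set.Icc ((k : ℝ) / n) ((k + 1) / n) := by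
  have hkn : (k : ℝ) < n := by exact_mod_cast hk
  have hn : (0 : ℝ) < n := lt_of_le_of_lt (Nat.cast_nonneg k) hkn
  constructor
  · rw [div_le_div_iff₀ hn (by positivity)]
    linarith
  · gcongr
    linarith

/-- The `L¹` distance between the distribution functions of the empirical mean and of the mixing
measure. -/
theorem HasMixingMeasure.lintegral_cdf_sub_le {Ω : Type*} [MeasurableSpace Ω] {P : Measure Ω}
    [IsProbabilityMeasure P] {X : ℕ → Ω → ℕ} {μ : Measure ℝ} [IsProbabilityMeasure μ]
    (hμ : ∀ᵐ y ∂μ, y ∈ Set.Icc (0 : ℝ) 1)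
    (hX : HasMixingMeasure P X μ) {n : ℕ} (hn : 1 ≤ n) :
    ∫⁻ x, ENNReal.ofReal |cdf (P.map (empiricalMean X n)) x - cdf μ x| ≤
      (∑ k ∈ Finset.range n,
        ‖(∫ t in Set.Icc (0 : ℝ) 1, binomialCdf n k t ∂μ) - cdf μ ((k + 1) / (n + 1))‖ₑ + 1) *
        ENNReal.ofReal (1 / n) := by
  have hmeas := hX.toIsZeroOneSequence.measurable_empiricalMean n
  have := Measure.isProbabilityMeasure_map (μ := P) hmeas.aemeasurable
  have hn0 : (0 : ℝ) < n := by exact_mod_cast hn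
  have hsupp : ∀ᵐ y ∂(P.map (empiricalMean X n)), y ∈ Set.Icc (0 : ℝ) 1 :=
    (ae_map_iff hmeas.aemeasurable measurableSet_Icc).2
      (Filter.Eventually.of_forall fun ω => hX.toIsZeroOneSequence.empiricalMean_mem n ω)
  -- The error on cell `k`: the distance to `F(m_k)`, plus the oscillation of `F` on the cell, whose
  -- closure contains `m_k`.
  set c : ℕ → ENNReal := fun k =>
    ‖(∫ t in Set.Icc (0 : ℝ) 1, binomialCdf n k t ∂μ) - cdf μ ((k + 1) / (n + 1))‖ₑ +
      ENNReal.ofReal (cdf μ (((k + 1 : ℕ) : ℝ) / n) - cdf μ ((k : ℝ) / n)) with hc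
  have hmono : ∀ k : ℕ, (k : ℝ) / n ≤ ((k + 1 : ℕ) : ℝ) / n := fun k => by
    gcongr
    omega
  have hpt : ∀ x, ENNReal.ofReal |cdf (P.map (empiricalMean X n)) x - cdf μ x| ≤
      ∑ k ∈ Finset.range n,
        (Set.Ico ((k : ℝ) / n) (((k + 1 : ℕ) : ℝ) / n)).indicator (fun _ => c k) x := by
    intro x
    rcases lt_or_ge x 0 with h0 | h0
    · simp [cdf_of_neg hsupp h0, cdf_of_neg hμ h0]
    rcases le_or_gt 1 x with h1 | h1
    · simp [cdf_of_one_le hsupp h1, cdf_of_one_le hμ h1]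
    obtain ⟨k, hk⟩ : ∃ k : ℕ, k = ⌊n * x⌋₊ := ⟨_, rfl⟩
    have hk1 : (k : ℝ) ≤ n * x := hk ▸ Nat.floor_le (by positivity)
    have hk2 : n * x < ((k + 1 : ℕ) : ℝ) := by
      push_cast
      exact hk ▸ Nat.lt_floor_add_one _
    have hkn : k < n := by
      have : (k : ℝ) < n := by nlinarith
      exact_mod_cast this
    have hx : x ∈ Set.Ico ((k : ℝ) / n) (((k + 1 : ℕ) : ℝ) / n) :=
      ⟨(div_le_iff₀' hn0).2 hk1, (lt_div_iff₀' hn0).2 hk2⟩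
    refine le_trans ?_ (Finset.single_le_sum (fun _ _ => zero_le) (Finset.mem_range.2 hkn))
    rw [Set.indicator_of_mem hx]
    simp only [hc]
    rw [Real.enorm_eq_ofReal_abs,
      ← ENNReal.ofReal_add (abs_nonneg _) (sub_nonneg.2 (monotone_cdf μ (hmono k))),
      hX.cdf_empiricalMean hn k (by simpa using hx)]
    refine ENNReal.ofReal_le_ofReal ?_
    have hm := orderStatistic_mean_mem_Icc hkn
    have e1 := monotone_cdf μ hm.1
    have e2 := monotone_cdf μ hm.2
    have e3 := monotone_cdf μ hx.1
    have e4 := monotone_cdf μ hx.2.le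
    push_cast at e4 ⊢
    have h2 : |cdf μ (((k : ℝ) + 1) / (n + 1)) - cdf μ x| ≤
        cdf μ (((k : ℝ) + 1) / n) - cdf μ ((k : ℝ) / n) :=
      abs_le.2 ⟨by linarith, by linarith⟩
    exact (abs_sub_le _ (cdf μ (((k : ℝ) + 1) / (n + 1))) _).trans (by linarith)
  calc ∫⁻ x, ENNReal.ofReal |cdf (P.map (empiricalMean X n)) x - cdf μ x|
      ≤ ∫⁻ x, ∑ k ∈ Finset.range n,
        (Set.Ico ((k : ℝ) / n) (((k + 1 : ℕ) : ℝ) / n)).indicator (fun _ => c k) x :=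
        lintegral_mono hpt
    _ = ∑ k ∈ Finset.range n, c k * ENNReal.ofReal (1 / n) := by
        rw [lintegral_finsetSum _ fun k _ => measurable_const.indicator measurableSet_Ico]
        refine Finset.sum_congr rfl fun k _ => ?_
        rw [lintegral_indicator_const measurableSet_Ico, Real.volume_Ico, ← sub_div]
        simp
    _ ≤ _ := by
        rw [← Finset.sum_mul, hc, Finset.sum_add_distrib]
        gcongr
        -- The increments of the distribution function over the cells telescope to at most 1.
        rw [← ENNReal.ofReal_sum_of_nonneg fun k _ => sub_nonneg.2 (monotone_cdf μ (hmono k)),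
          Finset.sum_range_sub (fun k : ℕ => cdf μ ((k : ℝ) / n)), ENNReal.ofReal_le_one]
        linarith [cdf_nonneg μ (((0 : ℕ) : ℝ) / n), cdf_le_one μ ((n : ℝ) / n)]

theorem HasMixingMeasure.wassersteinDist_le {Ω : Type*} [MeasurableSpace Ω] {P : Measure Ω}
    [IsProbabilityMeasure P] {X : ℕ → Ω → ℕ} {α β : ℝ} (hα : 0 < α) (hβ : 0 < β)
    (hX : HasMixingMeasure P X (betaMeasure α β)) {n : ℕ} (hn : 1 ≤ n) :
    wassersteinDist (P.map (empiricalMean X n)) (betaMeasure α β) ≤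
      ENNReal.ofReal (betaConst α β / n) := by
  have := isProbabilityMeasureBeta hα hβ
  have := Measure.isProbabilityMeasure_map (μ := P)
    (hX.toIsZeroOneSequence.measurable_empiricalMean n).aemeasurable
  have hsum := sum_enorm_integral_binomialCdf_sub_le (betaMeasure α β)
    (betaMeasure_restrict_Icc α β) (fun t ht => hasDerivAt_betaPDFReal α β ht)
    (continuousOn_betaPDFDeriv α β) (measurable_betaPDFDeriv α β)
    (fun m _ v _ => cdf_betaMeasure_sub hα hβ m v) hn
  rw [lintegral_betaPDFDeriv hα hβ, integral_abs_affine_betaMeasure hα hβ] at hsum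
  have hM := betaAbsMoment_nonneg hα hβ (α + β - 2) (1 - α)
  calc wassersteinDist (P.map (empiricalMean X n)) (betaMeasure α β)
      ≤ _ := wassersteinDist_le_lintegral_cdf _ _
    _ ≤ _ := hX.lintegral_cdf_sub_le ((ae_mem_Ioo_betaMeasure α β).mono
        fun _ h => Set.Ioo_subset_Icc_self h) hn
    _ ≤ (ENNReal.ofReal (betaAbsMoment α β (α + β - 2) (1 - α) / 2) + 1) *
          ENNReal.ofReal (1 / n) := by gcongr
    _ = ENNReal.ofReal ((1 + betaAbsMoment α β (α + β - 2) (1 - α) / 2) / n) := by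
        rw [← ENNReal.ofReal_one, ← ENNReal.ofReal_add (by positivity) zero_le_one,
          ← ENNReal.ofReal_mul (by positivity), mul_one_div, add_comm]
    _ ≤ _ := by
        refine ENNReal.ofReal_le_ofReal ?_
        gcongr
        exact one_add_half_betaAbsMoment_le_betaConst hα hβ

/-! ### The Pólya–Eggenberger urn -/

theorem urnWhite_eq (A m : ℕ) {n : ℕ} {e : Fin n → ℕ} (he : ∀ i, e i = 0 ∨ e i = 1) :
    urnWhite A m e = A + m * ∑ i, e i := by
  rw [urnWhite, Finset.mul_sum]
  congr 1
  refine Finset.sum_congr rfl fun i _ => ?_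
  rcases he i with h | h <;> simp [h]

theorem urnBlack_eq (B m : ℕ) {n : ℕ} {e : Fin n → ℕ} (he : ∀ i, e i = 0 ∨ e i = 1) :
    urnBlack B m e = B + m * (n - ∑ i, e i) := by
  have h : (∑ i, if e i = 0 then 1 else 0) + ∑ i, e i = n := by
    rw [← Finset.sum_add_distrib]
    calc ∑ i, ((if e i = 0 then 1 else 0) + e i) = ∑ _i : Fin n, 1 :=
          Finset.sum_congr rfl fun i _ => by rcases he i with h | h <;> simp [h]
      _ = n := by simp
  rw [urnBlack, ← Nat.eq_sub_of_add_eq h, Finset.mul_sum]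
  simp

theorem sum_le_of_zero_or_one {n : ℕ} {e : Fin n → ℕ} (he : ∀ i, e i = 0 ∨ e i = 1) :
    ∑ i, e i ≤ n := by
  calc ∑ i, e i ≤ ∑ _i : Fin n, 1 :=
        Finset.sum_le_sum fun i _ => by rcases he i with h | h <;> simp [h]
    _ = n := by simp

theorem historyEvent_succ {Ω : Type*} (X : ℕ → Ω → ℕ) {n : ℕ} (e : Fin (n + 1) → ℕ) :
    historyEvent X e =
      historyEvent X (fun i : Fin n => e i.castSucc) ∩ {ω | X n ω = e (Fin.last n)} := by
  ext ω
  simp [historyEvent, Fin.forall_fin_succ']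

theorem integral_pow_mul_pow_betaMeasure {α β : ℝ} (hα : 0 < α) (hβ : 0 < β) (k l : ℕ) :
    ∫ t in Set.Icc (0 : ℝ) 1, t ^ k * (1 - t) ^ l ∂betaMeasure α β =
      beta (α + k) (β + l) / beta α β := by
  rw [betaMeasure_restrict_Icc, integral_betaMeasure hα hβ,
    beta_eq_incompleteBeta_one (α := α + k) (β := β + l) (by positivity) (by positivity),
    incompleteBeta,
    intervalIntegral.integral_of_le zero_le_one, intervalIntegral.integral_of_le zero_le_one,
    integral_Ioc_eq_integral_Ioo, integral_Ioc_eq_integral_Ioo]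
  congr 1
  refine setIntegral_congr_fun measurableSet_Ioo fun t ht => ?_
  have h0 : t ≠ 0 := ht.1.ne'
  have h1 : 1 - t ≠ 0 := (sub_pos.2 ht.2).ne'
  rw [show α + k - 1 = α - 1 + k by ring, show β + l - 1 = β - 1 + l by ring,
    Real.rpow_add_natCast h0, Real.rpow_add_natCast h1]
  ring

/-- In units of `m` balls, each draw raises one of the parameters `A/m + k`, `B/m + l` by one, and
the conditional probability of the draw is exactly the factor in the Beta recurrence. -/
theorem IsPolyaUrn.measureReal_historyEvent {Ω : Type*} [MeasurableSpace Ω] {P : Measure Ω}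
    [IsProbabilityMeasure P] {A B m : ℕ} {X : ℕ → Ω → ℕ} (hA : 1 ≤ A) (hB : 1 ≤ B) (hm : 1 ≤ m)
    (hX : IsPolyaUrn P A B m X) : ∀ (n : ℕ) (e : Fin n → ℕ), (∀ i, e i = 0 ∨ e i = 1) →
      P.real (historyEvent X e) =
        beta ((A : ℝ) / m + (∑ i, e i : ℕ)) ((B : ℝ) / m + (n - ∑ i, e i : ℕ)) /
          beta ((A : ℝ) / m) ((B : ℝ) / m) := by
  have hA' : (0 : ℝ) < A := by exact_mod_cast hA
  have hB' : (0 : ℝ) < B := by exact_mod_cast hB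
  have hm' : (0 : ℝ) < m := by exact_mod_cast hm
  have hα : 0 < (A : ℝ) / m := by positivity
  have hβ : 0 < (B : ℝ) / m := by positivity
  intro n
  induction n with
  | zero =>
    intro e _
    have h : historyEvent X e = Set.univ := by
      ext ω
      simp [historyEvent]
    simp [h, (beta_pos hα hβ).ne']
  | succ n ih =>
    intro e he
    set e' : Fin n → ℕ := fun i => e i.castSucc with he'
    have he'01 : ∀ i, e' i = 0 ∨ e' i = 1 := fun i => he _
    have hle := sum_le_of_zero_or_one he'01
    obtain ⟨l, hl⟩ := Nat.exists_eq_add_of_le hle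
    set k := ∑ i, e' i with hk
    have hw := hX.prob_white n e' he'01
    rw [urnWhite_eq A m he'01, urnBlack_eq B m he'01, ih e' he'01, ← hk,
      show n - k = l by omega] at hw
    have hak : 0 < (A : ℝ) / m + k := by positivity
    have hbl : 0 < (B : ℝ) / m + l := by positivity
    have hfrac : ((A + m * k : ℕ) : ℝ) / ((A + m * k : ℕ) + (B + m * l : ℕ)) =
        ((A : ℝ) / m + k) / ((A : ℝ) / m + k + ((B : ℝ) / m + l)) := by
      push_cast
      field_simp
    rw [hfrac] at hw
    rw [historyEvent_succ, Fin.sum_univ_castSucc, ← he', ← hk]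
    rcases he (Fin.last n) with h | h
    · have hcompl : historyEvent X e' ∩ {ω | X n ω = 0} =
          historyEvent X e' \ {ω | X n ω = 1} := by
        ext ω
        rcases hX.zero_or_one n ω with h | h <;> simp [h]
      have hsplit := measureReal_inter_add_sdiff (μ := P) (s := historyEvent X e')
        (hX.measurable n (measurableSet_singleton 1))
      have hpre : X n ⁻¹' {1} = {ω | X n ω = 1} := rfl
      rw [hpre, hw, ih e' he'01, ← hk, show n - k = l by omega] at hsplit
      rw [h, hcompl, add_zero, show n + 1 - k = l + 1 by omega, Nat.cast_add_one,
        ← add_assoc ((B : ℝ) / m), beta_add_one_right hak hbl]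
      have hne : (A : ℝ) / m + k + ((B : ℝ) / m + l) ≠ 0 := by positivity
      have hfr : ((B : ℝ) / m + l) / ((A : ℝ) / m + k + ((B : ℝ) / m + l)) =
          1 - ((A : ℝ) / m + k) / ((A : ℝ) / m + k + ((B : ℝ) / m + l)) := by
        rw [eq_sub_iff_add_eq, ← add_div, add_comm, div_self hne]
      rw [hfr, mul_div_assoc]
      linarith
    · rw [h, hw, show n + 1 - (k + 1) = l by omega, Nat.cast_add_one,
        ← add_assoc ((A : ℝ) / m) (k : ℝ) 1, beta_add_one_left hak hbl]
      ring

/-- De Finetti's representation of the Pólya–Eggenberger urn. -/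
theorem IsPolyaUrn.hasMixingMeasure {Ω : Type*} [MeasurableSpace Ω] {P : Measure Ω}
    [IsProbabilityMeasure P] {A B m : ℕ} {X : ℕ → Ω → ℕ} (hA : 1 ≤ A) (hB : 1 ≤ B) (hm : 1 ≤ m)
    (hX : IsPolyaUrn P A B m X) :
    HasMixingMeasure P X (betaMeasure ((A : ℝ) / m) ((B : ℝ) / m)) where
  toIsZeroOneSequence := hX.toIsZeroOneSequence
  prob_history n e he := by
    have hA' : (0 : ℝ) < A := by exact_mod_cast hA
    have hB' : (0 : ℝ) < B := by exact_mod_cast hB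
    have hm' : (0 : ℝ) < m := by exact_mod_cast hm
    rw [hX.measureReal_historyEvent hA hB hm n e he,
      integral_pow_mul_pow_betaMeasure (by positivity) (by positivity)]

theorem corollary3p4
    {Ω : Type*} [MeasurableSpace Ω] (P : Measure Ω) [IsProbabilityMeasure P] (X : ℕ → Ω → ℕ)
    {Ω' : Type*} [MeasurableSpace Ω'] (P' : Measure Ω') [IsProbabilityMeasure P'] (θ : Ω' → ℝ) :
    (∀ α β : ℝ, 0 < α → 0 < β → HasLaw θ (betaMeasure α β) P' →
      (∀ a b : ℝ, ∫ ω, |a * θ ω + b| ∂P' = betaAbsMoment α β a b) ∧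
      (HasMixingMeasure P X (betaMeasure α β) → ∀ n : ℕ, 1 ≤ n →
        wassersteinDist (P.map (empiricalMean X n)) (P'.map θ)
          ≤ ENNReal.ofReal (betaConst α β / n))) ∧
    (∀ A B m : ℕ, 1 ≤ A → 1 ≤ B → 1 ≤ m → IsPolyaUrn P A B m X →
      HasLaw θ (betaMeasure ((A : ℝ) / m) ((B : ℝ) / m)) P' → ∀ n : ℕ, 1 ≤ n →
        wassersteinDist (P.map (empiricalMean X n)) (P'.map θ)
          ≤ ENNReal.ofReal (betaConst ((A : ℝ) / m) ((B : ℝ) / m) / n)) := by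
  refine ⟨fun α β hα hβ hθ => ⟨fun a b => ?_, fun hX n hn => ?_⟩,
    fun A B m hA hB hm hX hθ n hn => ?_⟩
  · rw [← integral_abs_affine_betaMeasure hα hβ, ← hθ.map_eq,
      integral_map hθ.aemeasurable (by fun_prop)]
  · rw [hθ.map_eq]
    exact hX.wassersteinDist_le hα hβ hn
  · have hA' : (0 : ℝ) < A := by exact_mod_cast hA
    have hB' : (0 : ℝ) < B := by exact_mod_cast hB
    have hm' : (0 : ℝ) < m := by exact_mod_cast hm
    rw [hθ.map_eq]
    exact (hX.hasMixingMeasure hA hB hm).wassersteinDist_le (by positivity) (by positivity) hn
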